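/- Identify a graphon, i.e. a symmetric Lebesgue measurable function $W:[0,1]^2\to[-1,1]$, with the bounded operator $[Wv](x)=\int_0^1 W(x,y)v(y)\,dy$ on the real Hilbert space $L^2[0,1]$, and let $I$ denote the identity operator. Fix $n\ge 1$. For each $N\ge 1$ consider a network system $$\dot x_t=\alpha_N x_t+\tfrac1{nN}A_N x_t+\beta_N u_t+\tfrac1{nN}B_N u_t,\qquad x_t,u_t\in\mathbb R^{nN},$$ where $\alpha_N,\beta_N\in\mathbb R$ and $A_N,B_N$ are symmetric $nN\times nN$ real matrices with entries in $[-1,1]$. Let $A^{[N]}(x,y)=\sum_{i,j=1}^{nN}\mathbf 1_{P_i}(x)\mathbf 1_{P_j}(y)(A_N)_{ij}$ and $B^{[N]}(x,y)=\sum_{i,j=1}^{nN}\mathbf 1_{P_i}(x)\mathbf 1_{P_j}(y)(B_N)_{ij}$ be the step-function graphons over the uniform partition $P_k=[\frac{k-1}{nN},\frac{k}{nN})$ for $k<nN$, $P_{nN}=[\frac{nN-1}{nN},1]$, and put $\mathbb A^{[N]}=\alpha_N I+A^{[N]}$, $\mathbb B^{[N]}=\beta_N I+B^{[N]}$. Let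 $\alpha,\beta\in\mathbb R$, let $A,B$ be graphons, and put $\mathbb A=\alpha I+A$, $\mathbb B=\beta I+B$. Let $\mathbb C,\mathbb C^{[N]},\mathbb P_0,\mathbb P_0^{[N]}$ $(N\ge1)$ be bounded linear operators on $L^2[0,1]$. Assume that 1. each $\mathbb P_0^{[N]}$ is self-adjoint and non-negative; 2. $\alpha_N\to\alpha$, $\beta_N\to\beta$, $\|A-A^{[N]}\|_{\mathrm{op}}\to0$ and $\|B-B^{[N]}\|_{\mathrm{op}}\to0$ as $N\to\infty$; 3. $\mathbb C^{[N]}v\to\mathbb C v$ and $\mathbb P_0^{[N]}v\to\mathbb P_0v$ in $L^2[0,1]$ for every $v\in L^2[0,1]$; 4. $\mathbb C$ and all $\mathbb C^{[N]}$ are self-adjoint. Let $T>0$. A solution on $[0,T]$ of the Riccati equation $\mathrm{Ricc}(\mathbb A,\mathbb B,\mathbb C,\mathbb P_0)$, $$\dot{\mathbb P}=\mathbb A^{\top}\mathbb P+\mathbb P\mathbb A-\mathbb P\mathbb B\mathbb B^{\top}\mathbb P+\mathbb C^{\top}\mathbb C,\qquad \mathbb P(0)=\mathbb P_0,$$ is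 a strongly continuous function $t\mapsto\mathbb P_t$ from $[0,T]$ to the self-adjoint non-negative bounded operators on $L^2[0,1]$ with $\mathbb P(0)=\mathbb P_0$ such that, for every $v\in L^2[0,1]$, $t\mapsto\mathbb P_tv$ is differentiable in $L^2[0,1]$ on $[0,T]$ (one-sidedly at the end points) and the equation holds when applied to $v$. Let $\mathbb P$ be the solution of $\mathrm{Ricc}(\mathbb A,\mathbb B,\mathbb C,\mathbb P_0)$ on $[0,T]$ and, for each $N\ge1$, let $\mathbb P^{[N]}$ be the solution of $\mathrm{Ricc}(\mathbb A^{[N]},\mathbb B^{[N]},\mathbb C^{[N]},\mathbb P_0^{[N]})$ on $[0,T]$. Then $\mathbb P^{[N]}\to\mathbb P$ in $C_s([0,T];\Sigma(L^2[0,1]))$, the space of strongly continuous functions from $[0,T]$ to the self-adjoint bounded operators on $L^2[0,1]$; that is, $$\lim_{N\to\infty}\ \sup_{t\in[0,T]}\big\|\mathbb P^{[N]}_t v-\mathbb P_t v\big\|_{2}=0\qquad\text{for every } v\in L^2[0,1].$$ -/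

import Mathlib

open MeasureTheory Filter Topology Set
open scoped unitInterval

noncomputable section

/-- The real Hilbert space `L²[0,1]` (Lebesgue measure). -/
abbrev L2I : Type := Lp ℝ 2 (volume : Measure I)

/-- A graphon: a symmetric Lebesgue measurable function `[0,1]² → [-1,1]`. -/
structure Graphon where
  toFun : I → I → ℝ
  aemeasurable' : AEMeasurable (Function.uncurry toFun)
    ((volume : Measure I).prod (volume : Measure I))
  symm' : ∀ x y, toFun x y = toFun y x
  bound' : ∀ x y, toFun x y ∈ Icc (-1 : ℝ) 1

namespace Graphon

variable (W : Graphon)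

/-- The function `x ↦ ∫₀¹ W(x,y) v(y) dy`. -/
def integral (v : I → ℝ) (x : I) : ℝ := ∫ y, W.toFun x y * v y

theorem abs_le (x y : I) : ‖W.toFun x y‖ ≤ 1 := by
  rw [Real.norm_eq_abs, _root_.abs_le]; exact W.bound' x y

theorem ae_integrable {v : I → ℝ} (hv : Integrable v) :
    ∀ᵐ x : I, Integrable (fun y => W.toFun x y * v y) := by
  have h := W.aemeasurable'.aestronglyMeasurable.prodMk_left
  filter_upwards [h] with x hx
  exact hv.bdd_mul (c := 1) hx (ae_of_all _ fun y => W.abs_le x y)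

theorem integral_aestronglyMeasurable {v : I → ℝ} (hv : Integrable v) :
    AEStronglyMeasurable (W.integral v) volume := by
  have h : AEStronglyMeasurable (fun p : I × I => W.toFun p.1 p.2 * v p.2)
      ((volume : Measure I).prod volume) :=
    W.aemeasurable'.aestronglyMeasurable.mul hv.aestronglyMeasurable.comp_snd
  exact h.integral_prod_right'

theorem integral_norm_le {v : I → ℝ} (hv : Integrable v) (x : I) :
    ‖W.integral v x‖ ≤ ∫ y, ‖v y‖ := by
  refine norm_integral_le_of_norm_le hv.norm (ae_of_all _ fun y => ?_)
  rw [norm_mul]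
  exact mul_le_of_le_one_left (norm_nonneg _) (W.abs_le x y)

theorem integral_memLp {v : I → ℝ} (hv : Integrable v) : MemLp (W.integral v) 2 volume :=
  MemLp.of_bound (W.integral_aestronglyMeasurable hv) _
    (ae_of_all _ (W.integral_norm_le hv))

theorem _root_.L2I.integrable (v : L2I) : Integrable (v : I → ℝ) :=
  (Lp.memLp v).integrable (by norm_num)

theorem _root_.L2I.integral_norm_le (v : L2I) : ∫ y, ‖v y‖ ≤ ‖v‖ := by
  have h := eLpNorm_le_eLpNorm_of_exponent_le (μ := (volume : Measure I)) (p := 1) (q := 2)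
    (by norm_num) (Lp.memLp v).1
  rw [Lp.norm_def, integral_norm_eq_lintegral_enorm (Lp.memLp v).1, ← eLpNorm_one_eq_lintegral_enorm]
  exact ENNReal.toReal_mono (Lp.memLp v).2.ne h

/-- The operator on `L²[0,1]` given by `[W v](x) = ∫₀¹ W(x,y) v(y) dy`. -/
def toOp : L2I →L[ℝ] L2I :=
  LinearMap.mkContinuous
    { toFun := fun v => (W.integral_memLp v.integrable).toLp (W.integral v)
      map_add' := by
        intro u v
        rw [← MemLp.toLp_add, MemLp.toLp_eq_toLp_iff]
        filter_upwards [W.ae_integrable u.integrable, W.ae_integrable v.integrable] with x hu hv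
        simp only [Pi.add_apply, integral]
        rw [← integral_add hu hv]
        refine integral_congr_ae ?_
        filter_upwards [Lp.coeFn_add u v] with y hy
        rw [hy, Pi.add_apply, mul_add]
      map_smul' := by
        intro c v
        rw [RingHom.id_apply, ← MemLp.toLp_const_smul, MemLp.toLp_eq_toLp_iff]
        refine ae_of_all _ fun x => ?_
        simp only [Pi.smul_apply, integral, smul_eq_mul]
        rw [← integral_const_mul]
        refine integral_congr_ae ?_
        filter_upwards [Lp.coeFn_smul c v] with y hy
        rw [hy, Pi.smul_apply, smul_eq_mul]; ring }
    1 (by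
      intro v
      rw [one_mul]
      refine le_trans ?_ v.integral_norm_le
      have h := Lp.norm_le_of_ae_bound (p := 2) (μ := (volume : Measure I))
        (f := (W.integral_memLp v.integrable).toLp (W.integral v))
        (C := ∫ y, ‖v y‖) (integral_nonneg fun _ => norm_nonneg _) (by
          filter_upwards [(W.integral_memLp v.integrable).coeFn_toLp] with x hx
          rw [hx]; exact W.integral_norm_le v.integrable x)
      simpa [measureUnivNNReal] using h)

/-- `toOp` is the integral operator with kernel `W`. -/
theorem toOp_coeFn (v : L2I) : (W.toOp v : I → ℝ) =ᵐ[volume] fun x => ∫ y, W.toFun x y * v y :=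
  (W.integral_memLp v.integrable).coeFn_toLp

end Graphon

/-- The `k`-th cell (`k = 0, …, d - 1`) of the uniform partition of `[0,1]` into `d` intervals:
`[k/d, (k+1)/d)` for `k + 1 < d`, and `[(d-1)/d, 1]` for `k + 1 = d`. -/
def uniformCell (d : ℕ) (k : Fin d) : Set I :=
  {x | (k : ℝ) / d ≤ (x : ℝ) ∧ ((x : ℝ) < ((k : ℝ) + 1) / d ∨ (k : ℕ) + 1 = d)}

theorem measurableSet_uniformCell (d : ℕ) (k : Fin d) : MeasurableSet (uniformCell d k) := by
  have h1 : MeasurableSet {x : I | (k : ℝ) / d ≤ (x : ℝ)} :=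
    measurableSet_le measurable_const measurable_subtype_coe
  have h2 : MeasurableSet {x : I | (x : ℝ) < ((k : ℝ) + 1) / d} :=
    measurableSet_lt measurable_subtype_coe measurable_const
  exact h1.inter (h2.union (MeasurableSet.const _))

theorem uniformCell_le {d : ℕ} {i j : Fin d} {x : I}
    (hi : x ∈ uniformCell d i) (hj : x ∈ uniformCell d j) : i ≤ j := by
  have hd : (0 : ℝ) < d := by exact_mod_cast i.pos
  rcases hj.2 with h | h
  · have h3 := hi.1.trans_lt h
    rw [div_lt_div_iff_of_pos_right hd] at h3
    have h4 : (i : ℕ) < (j : ℕ) + 1 := by exact_mod_cast h3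
    exact Fin.le_def.2 (by omega)
  · have := i.isLt
    exact Fin.le_def.2 (by omega)

theorem sum_uniformCell_le (d : ℕ) (x : I) :
    ∑ i, (uniformCell d i).indicator (fun _ => (1 : ℝ)) x ≤ 1 := by
  by_cases h : ∃ i, x ∈ uniformCell d i
  · obtain ⟨i, hi⟩ := h
    rw [Finset.sum_eq_single i]
    · simp [hi]
    · intro j _ hj
      refine indicator_of_notMem (fun hj' => hj ?_) _
      exact le_antisymm (uniformCell_le hj' hi) (uniformCell_le hi hj')
    · simp
  · push Not at h
    rw [Finset.sum_eq_zero fun i _ => indicator_of_notMem (h i) _]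
    exact zero_le_one

/-- The step function `∑ᵢ ∑ⱼ 1_{Pᵢ}(x) 1_{Pⱼ}(y) Mᵢⱼ` of a symmetric matrix with entries in
`[-1,1]`, over the uniform partition. -/
def stepGraphon {d : ℕ} (M : Matrix (Fin d) (Fin d) ℝ) (hs : M.IsSymm)
    (hb : ∀ i j, M i j ∈ Icc (-1 : ℝ) 1) : Graphon where
  toFun x y := ∑ i, ∑ j, (uniformCell d i).indicator (fun _ => (1 : ℝ)) x *
    (uniformCell d j).indicator (fun _ => (1 : ℝ)) y * M i j
  aemeasurable' := by
    refine Measurable.aemeasurable ?_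
    have hm : ∀ i, Measurable ((uniformCell d i).indicator (fun _ => (1 : ℝ))) := fun i =>
      measurable_const.indicator (measurableSet_uniformCell d i)
    refine Finset.measurable_sum _ fun i _ => Finset.measurable_sum _ fun j _ => ?_
    exact (((hm i).comp measurable_fst).mul ((hm j).comp measurable_snd)).mul_const _
  symm' x y := by
    rw [Finset.sum_comm]
    refine Finset.sum_congr rfl fun i _ => Finset.sum_congr rfl fun j _ => ?_
    rw [hs.apply i j]; ring
  bound' x y := by
    have h0 : ∀ (i : Fin d) (z : I), 0 ≤ (uniformCell d i).indicator (fun _ => (1 : ℝ)) z :=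
      fun i z => indicator_nonneg (fun _ _ => zero_le_one) z
    rw [mem_Icc, ← _root_.abs_le]
    calc _ ≤ ∑ i, ∑ j, (uniformCell d i).indicator (fun _ => (1 : ℝ)) x *
          (uniformCell d j).indicator (fun _ => (1 : ℝ)) y := by
            refine (Finset.abs_sum_le_sum_abs _ _).trans (Finset.sum_le_sum fun i _ => ?_)
            refine (Finset.abs_sum_le_sum_abs _ _).trans (Finset.sum_le_sum fun j _ => ?_)
            rw [abs_mul, abs_of_nonneg (mul_nonneg (h0 i x) (h0 j y))]
            exact mul_le_of_le_one_right (mul_nonneg (h0 i x) (h0 j y))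
              (_root_.abs_le.2 (hb i j))
      _ = (∑ i, (uniformCell d i).indicator (fun _ => (1 : ℝ)) x) *
          ∑ j, (uniformCell d j).indicator (fun _ => (1 : ℝ)) y := by
            rw [Finset.sum_mul_sum]
      _ ≤ 1 := mul_le_one₀ (sum_uniformCell_le d x)
          (Finset.sum_nonneg fun j _ => h0 j y) (sum_uniformCell_le d y)

/-- A network system of `N` subsystems with `n`-dimensional states,
`ẋ = α x + (1/(nN)) A x + β u + (1/(nN)) B u` on `ℝ^{nN}`, where `A` and `B` are symmetric with
entries in `[-1,1]`. -/
structure NetworkSystem (n N : ℕ) where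
  α : ℝ
  β : ℝ
  A : Matrix (Fin (n * N)) (Fin (n * N)) ℝ
  B : Matrix (Fin (n * N)) (Fin (n * N)) ℝ
  A_symm : A.IsSymm
  B_symm : B.IsSymm
  A_bound : ∀ i j, A i j ∈ Icc (-1 : ℝ) 1
  B_bound : ∀ i j, B i j ∈ Icc (-1 : ℝ) 1

/-- A graphon system `ẋ = (α I + A) x + (β I + B) u` on `L²[0,1]`. -/
structure GraphonSystem where
  α : ℝ
  β : ℝ
  A : Graphon
  B : Graphon

namespace GraphonSystem

/-- The state operator `α I + A`. -/
def opA (S : GraphonSystem) : L2I →L[ℝ] L2I := S.α • ContinuousLinearMap.id ℝ L2I + S.A.toOp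

/-- The input operator `β I + B`. -/
def opB (S : GraphonSystem) : L2I →L[ℝ] L2I := S.β • ContinuousLinearMap.id ℝ L2I + S.B.toOp

/-- Convergence of a sequence of systems `(α_N I + A_N; β_N I + B_N)` to `(α I + A; β I + B)`. -/
structure ConvergesTo (S : ℕ+ → GraphonSystem) (S' : GraphonSystem) : Prop where
  α : Tendsto (fun N => (S N).α) atTop (𝓝 S'.α)
  β : Tendsto (fun N => (S N).β) atTop (𝓝 S'.β)
  A : Tendsto (fun N => ‖S'.A.toOp - (S N).A.toOp‖) atTop (𝓝 0)
  B : Tendsto (fun N => ‖S'.B.toOp - (S N).B.toOp‖) atTop (𝓝 0)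

end GraphonSystem

/-- The equivalent representation of a network system on `L²[0,1]` by step functions. -/
def NetworkSystem.toGraphonSystem {n N : ℕ} (S : NetworkSystem n N) : GraphonSystem where
  α := S.α
  β := S.β
  A := stepGraphon S.A S.A_symm S.A_bound
  B := stepGraphon S.B S.B_symm S.B_bound

/-- Strong operator convergence of a sequence of bounded operators. -/
def StrongTendsto (F : ℕ+ → L2I →L[ℝ] L2I) (G : L2I →L[ℝ] L2I) : Prop :=
  ∀ v : L2I, Tendsto (fun N => F N v) atTop (𝓝 (G v))

/-- `F`, restricted to `[0,T]`, belongs to `C_s([0,T]; Σ(L²[0,1]))`: its values are bounded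
self-adjoint operators and it is strongly continuous. -/
structure MemCs (T : ℝ) (F : ℝ → L2I →L[ℝ] L2I) : Prop where
  selfAdjoint : ∀ t ∈ Icc 0 T, IsSelfAdjoint (F t)
  continuousOn : ∀ v : L2I, ContinuousOn (fun t => F t v) (Icc 0 T)

/-- Convergence in `C_s([0,T]; Σ(L²[0,1]))`: for each `v`, `F_N(t) v → G(t) v` uniformly in
`t ∈ [0,T]`. -/
structure TendstoCs (T : ℝ) (F : ℕ+ → ℝ → L2I →L[ℝ] L2I) (G : ℝ → L2I →L[ℝ] L2I) : Prop where
  mem : ∀ N, MemCs T (F N)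
  mem_limit : MemCs T G
  tendsto : ∀ v : L2I, TendstoUniformlyOn (fun N t => F N t v) (fun t => G t v) atTop (Icc 0 T)

open ContinuousLinearMap in
/-- `P` solves, on `[0,T]`, the Riccati equation `Ṗ = Aᵀ P + P A - P B Bᵀ P + Cᵀ C`, `P(0) = P₀`,
in the class `C_s([0,T]; Σ⁺(L²[0,1]))` of strongly continuous functions whose values are
self-adjoint and non-negative; the derivative is the strong one (one-sided at `0` and `T`). -/
structure IsRiccatiSolution (A B C P₀ : L2I →L[ℝ] L2I) (T : ℝ) (P : ℝ → L2I →L[ℝ] L2I) :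
    Prop where
  mem : MemCs T P
  nonneg : ∀ t ∈ Icc 0 T, ∀ v : L2I, 0 ≤ inner ℝ (P t v) v
  initial : P 0 = P₀
  hasDeriv : ∀ v : L2I, ∀ t ∈ Icc 0 T, HasDerivWithinAt (fun s => P s v)
    ((adjoint A ∘L P t + P t ∘L A - P t ∘L B ∘L adjoint B ∘L P t + adjoint C ∘L C) v)
    (Icc 0 T) t

end

/-! The difference `D = P_N - P` solves a linear equation `D' = G D + D F + R`, where `G = A_Nᵀ -
P_N B_N B_Nᵀ`, `F = A - B Bᵀ P`, and `R` collects the errors in the data. `R` tends to zero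
strongly, uniformly in time, provided the `P_N` are equibounded.

Equiboundedness (`IsRiccatiSolution.norm_le`) follows from the quadratic form `⟨P v, v⟩`, in whose
derivative the term `-P B Bᵀ P` is non-positive.

Grönwall at a fixed `v` does not close, because `D F v` evaluates `D` at the moving vector `F t v`.
These vectors form a compact set, on which pointwise bounds for an equibounded family become
uniform. Each integration of the equation then halves a bound on `D`, and iterating gives
convergence (`eventually_norm_le_of_hasDerivWithinAt`). -/

section Hilbert

variable {H : Type*} [NormedAddCommGroup H] [InnerProductSpace ℝ H]

/-- The norm of a non-negative self-adjoint operator is bounded by its quadratic form. -/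
theorem norm_le_of_inner_self_le [CompleteSpace H] {S : H →L[ℝ] H} (hS : IsSelfAdjoint S) {m : ℝ}
    (hm : 0 ≤ m) (h0 : ∀ v, 0 ≤ inner ℝ (S v) v) (h : ∀ v, inner ℝ (S v) v ≤ m * ‖v‖ ^ 2) :
    ‖S‖ ≤ m := by
  rw [ContinuousLinearMap.norm_eq_iSup_rayleighQuotient S hS.isSymmetric]
  refine Real.iSup_le (fun v => ?_) hm
  have h1 : S.rayleighQuotient v = inner ℝ (S v) v / ‖v‖ ^ 2 := rfl
  rw [h1, abs_of_nonneg (div_nonneg (h0 v) (sq_nonneg _))]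
  exact div_le_of_le_mul₀ (sq_nonneg _) hm (h v)

/-- Closes the halving iterations: the crude initial bound `c` disappears in the limit. -/
theorem le_of_forall_halving {x c d : ℝ} (h : ∀ k : ℕ, x ≤ c / 2 ^ k + d) : x ≤ d := by
  have h1 : Tendsto (fun k : ℕ => c / 2 ^ k + d) atTop (𝓝 (0 + d)) := by
    refine Tendsto.add_const d ?_
    have h2 := (tendsto_pow_atTop_nhds_zero_of_lt_one (r := (1 / 2 : ℝ)) (by norm_num)
      (by norm_num)).const_mul c
    simpa [div_eq_mul_inv] using h2
  rw [zero_add] at h1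
  exact ge_of_tendsto' h1 h

theorem HasDerivWithinAt.Ici_of_Icc {E : Type*} [NormedAddCommGroup E] [NormedSpace ℝ E]
    {f : ℝ → E} {f' : E} {a b t : ℝ} (h : HasDerivWithinAt f f' (Icc a b) t) (ht : t ∈ Ico a b) :
    HasDerivWithinAt f f' (Ici t) t :=
  (h.mono (Icc_subset_Icc_left ht.1)).mono_of_mem_nhdsWithin (Icc_mem_nhdsGE ht.2)

/-! ### Linear operator equations in the strong topology -/

/-- Eventual bounds for an equibounded family of operators that hold at each vector hold uniformly
on compact sets. -/
theorem eventually_norm_le_on_isCompact {ι X : Type*} {l : Filter ι} {s : Set X}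
    {D : ι → X → H →L[ℝ] H} {c β : ℝ} {b : X → ℝ} (hD : ∀ i, ∀ t ∈ s, ‖D i t‖ ≤ c)
    (hc : 0 ≤ c) (hβ : 0 ≤ β) (hb0 : ∀ t ∈ s, 0 ≤ b t) (hb : ∀ t ∈ s, b t ≤ β)
    (h : ∀ v, ∀ ε > 0, ∀ᶠ i in l, ∀ t ∈ s, ‖D i t v‖ ≤ b t * ‖v‖ + ε)
    {K : Set H} (hK : IsCompact K) {ε : ℝ} (hε : 0 < ε) :
    ∀ᶠ i in l, ∀ t ∈ s, ∀ w ∈ K, ‖D i t w‖ ≤ b t * ‖w‖ + ε := by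
  -- By compactness it suffices to treat a small ball around each point; there equiboundedness
  -- carries the bound at the centre over to its neighbours.
  refine hK.induction_on (p := fun Q => ∀ᶠ i in l, ∀ t ∈ s, ∀ w ∈ Q, ‖D i t w‖ ≤ b t * ‖w‖ + ε)
    (by simp) (fun Q Q' hQ h' => ?_) (fun Q Q' h1 h2 => ?_) (fun v _ => ?_)
  · filter_upwards [h'] with i hi t ht w hw using hi t ht w (hQ hw)
  · filter_upwards [h1, h2] with i h1 h2 t ht w hw
    exact hw.elim (h1 t ht w) (h2 t ht w)
  · have hpos : 0 < c + β + 1 := by positivity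
    set δ := ε / 2 / (c + β + 1) with hδ
    have hδ0 : 0 < δ := by positivity
    have hδ1 : (c + β) * δ ≤ ε / 2 := by
      have : (c + β + 1) * δ = ε / 2 := by rw [hδ]; field_simp
      nlinarith
    refine ⟨Metric.ball v δ, mem_nhdsWithin_of_mem_nhds (Metric.ball_mem_nhds v hδ0), ?_⟩
    filter_upwards [h v (ε / 2) (by positivity)] with i hi t ht w hw
    rw [mem_ball_iff_norm] at hw
    have h1 : ‖D i t (w - v)‖ ≤ c * δ :=
      ((D i t).le_of_opNorm_le (hD i t ht) _).trans (by gcongr)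
    have h2 : ‖D i t w‖ ≤ ‖D i t v‖ + ‖D i t (w - v)‖ := by
      have h4 : D i t w = D i t v + D i t (w - v) := by rw [← map_add]; simp
      rw [h4]; exact norm_add_le _ _
    have h3 : b t * ‖v‖ ≤ b t * ‖w‖ + β * δ := by
      have h5 : ‖v‖ ≤ ‖w‖ + δ := by
        have := norm_le_norm_add_norm_sub w v
        linarith
      calc b t * ‖v‖ ≤ b t * (‖w‖ + δ) := by gcongr; exact hb0 t ht
        _ = b t * ‖w‖ + b t * δ := by ring
        _ ≤ _ := by gcongr; exact hb t ht
    linarith [hi t ht]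

/-- Stability of linear operator differential equations `D' = G D + D F + R` in the strong
topology. -/
theorem eventually_norm_le_of_hasDerivWithinAt {ι : Type*} {l : Filter ι} {T : ℝ} (hT : 0 < T)
    {D G R : ι → ℝ → H →L[ℝ] H} {F : ℝ → H →L[ℝ] H} {c m : ℝ}
    (hD : ∀ i, ∀ t ∈ Icc 0 T, ‖D i t‖ ≤ c) (hG : ∀ i, ∀ t ∈ Icc 0 T, ‖G i t‖ ≤ m)
    (hc : 0 ≤ c) (hm : 0 ≤ m)
    (hF : ∀ t ∈ Icc 0 T, ‖F t‖ ≤ m) (hFc : ∀ v, ContinuousOn (fun t => F t v) (Icc 0 T))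
    (hderiv : ∀ i v, ∀ t ∈ Icc 0 T, HasDerivWithinAt (fun s => D i s v)
      (G i t (D i t v) + D i t (F t v) + R i t v) (Icc 0 T) t)
    (hD0 : ∀ v, ∀ ε > 0, ∀ᶠ i in l, ‖D i 0 v‖ ≤ ε)
    (hR : ∀ v, ∀ ε > 0, ∀ᶠ i in l, ∀ t ∈ Icc 0 T, ‖R i t v‖ ≤ ε)
    (v : H) {ε : ℝ} (hε : 0 < ε) : ∀ᶠ i in l, ∀ t ∈ Icc 0 T, ‖D i t v‖ ≤ ε := by
  -- The weight `exp (4 m t)` makes each integration gain a factor `1/2`. The eventual set of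
  -- indices may depend on `k`, `v` and `ε`.
  have step : ∀ k : ℕ, ∀ v, ∀ ε > 0, ∀ᶠ i in l, ∀ t ∈ Icc 0 T,
      ‖D i t v‖ ≤ c / 2 ^ k * Real.exp (4 * m * t) * ‖v‖ + ε := by
    intro k
    induction k with
    | zero =>
      intro v ε hε
      refine Eventually.of_forall fun i t ht => ?_
      have h1 : 1 ≤ Real.exp (4 * m * t) := Real.one_le_exp (by have := ht.1; positivity)
      have h2 : c ≤ c * Real.exp (4 * m * t) := le_mul_of_one_le_right hc h1
      have h3 := (D i t).le_of_opNorm_le (hD i t ht) v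
      have h4 : c * ‖v‖ ≤ c * Real.exp (4 * m * t) * ‖v‖ := by gcongr
      simp only [pow_zero, div_one]
      linarith
    | succ k ih =>
      intro v ε hε
      -- The slack grows at rate `m η` from `G D`, `η` from `D F` and `η` from `R`, starting from
      -- `η` at time zero; at time `T` it totals `ε`.
      set η := ε / ((m + 2) * T + 1) with hη
      have hη0 : 0 < η := by positivity
      have hη1 : (m + 2) * η * T + η = ε := by rw [hη]; field_simp
      set q := c / 2 ^ k with hq
      have hq0 : 0 ≤ q := by positivity
      have hcomp := eventually_norm_le_on_isCompact (l := l) (D := D) hD hc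
        (b := fun t => q * Real.exp (4 * m * t)) (β := q * Real.exp (4 * m * T)) (by positivity)
        (fun t _ => by positivity) (fun t ht => by gcongr; exact ht.2) ih
        (isCompact_Icc.image_of_continuousOn (hFc v)) hη0
      filter_upwards [ih v η hη0, hcomp, hD0 v η hη0, hR v η hη0] with i h1 h2 h3 h4 t ht
      have hB : ∀ x, HasDerivAt
          (fun s => q / 2 * ‖v‖ * Real.exp (4 * m * s) + ((m + 2) * η * s + η))
          (q / 2 * ‖v‖ * (Real.exp (4 * m * x) * (4 * m)) + (m + 2) * η) x := by
        intro x
        have e1 : HasDerivAt (fun s : ℝ => 4 * m * s) (4 * m) x := by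
          simpa using (hasDerivAt_id x).const_mul (4 * m)
        have e2 : HasDerivAt (fun s : ℝ => (m + 2) * η * s + η) ((m + 2) * η) x := by
          simpa using ((hasDerivAt_id x).const_mul ((m + 2) * η)).add_const η
        exact (e1.exp.const_mul _).add e2
      have key := image_norm_le_of_norm_deriv_right_le_deriv_boundary
        (f := fun s => D i s v) (a := 0) (b := T)
        (fun s hs => (hderiv i v s hs).continuousWithinAt)
        (fun s hs => (hderiv i v s (Ico_subset_Icc_self hs)).Ici_of_Icc hs)
        (by simp only [mul_zero, Real.exp_zero]; have : 0 ≤ q / 2 * ‖v‖ * 1 := by positivity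
            linarith) hB ?_ ht
      · have : (m + 2) * η * t ≤ (m + 2) * η * T := by gcongr; exact ht.2
        have e : c / 2 ^ (k + 1) = q / 2 := by rw [hq, pow_succ, div_div]
        rw [e]
        linarith
      -- `G D` and `D F` each contribute `m q exp (4 m s) ‖v‖`; the sum is exactly the derivative of
      -- `(q / 2) exp (4 m s) ‖v‖`.
      · intro s hs'
        have hs := Ico_subset_Icc_self hs'
        have b1 : ‖G i s (D i s v)‖ ≤ m * (q * Real.exp (4 * m * s) * ‖v‖ + η) :=
          ((G i s).le_of_opNorm_le (hG i s hs) _).trans (by gcongr; exact h1 s hs)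
        have b2 : ‖D i s (F s v)‖ ≤ q * Real.exp (4 * m * s) * (m * ‖v‖) + η := by
          refine (h2 s hs _ (mem_image_of_mem _ hs)).trans ?_
          gcongr
          exact (F s).le_of_opNorm_le (hF s hs) v
        have b3 := norm_add₃_le (a := G i s (D i s v)) (b := D i s (F s v)) (c := R i s v)
        linarith [h4 s hs]
  obtain ⟨k, hk⟩ : ∃ k : ℕ, c / 2 ^ k * (Real.exp (4 * m * T) * ‖v‖) < ε / 2 := by
    by_contra! hcon
    have h5 : ε / 2 ≤ 0 := le_of_forall_halving (c := c * (Real.exp (4 * m * T) * ‖v‖))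
      fun k => by have := hcon k; rw [add_zero, mul_div_right_comm]; exact this
    linarith
  filter_upwards [step k v (ε / 2) (by positivity)] with i hi t ht
  have h6 : c / 2 ^ k * Real.exp (4 * m * t) * ‖v‖ ≤
      c / 2 ^ k * Real.exp (4 * m * T) * ‖v‖ := by gcongr; exact ht.2
  linarith [hi t ht]

/-- Banach–Steinhaus; convergent sequences are bounded, after reindexing `ℕ+` by `ℕ`. -/
theorem exists_norm_le_of_tendsto [CompleteSpace H] {F : ℕ+ → H →L[ℝ] H} {G : H →L[ℝ] H}
    (h : ∀ v, Tendsto (fun N => F N v) atTop (𝓝 (G v))) :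
    ∃ a, 0 ≤ a ∧ ‖G‖ ≤ a ∧ ∀ N, ‖F N‖ ≤ a := by
  obtain ⟨a, ha⟩ := banach_steinhaus (g := F) fun v => by
    have h1 : Tendsto (fun k : ℕ => ‖F k.succPNat v‖) atTop (𝓝 ‖G v‖) :=
      ((h v).comp (tendsto_atTop_atTop.2 fun b => ⟨b, fun k hk =>
        PNat.coe_le_coe _ _ |>.1 (hk.trans k.le_succ)⟩ : Tendsto Nat.succPNat atTop atTop)).norm
    obtain ⟨c, hc⟩ := h1.bddAbove_range
    refine ⟨c, fun N => ?_⟩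
    rw [← N.succPNat_natPred]
    exact hc ⟨_, rfl⟩
  exact ⟨max a ‖G‖, le_max_of_le_right (norm_nonneg _), le_max_right _ _,
    fun N => (ha N).trans (le_max_left _ _)⟩

end Hilbert

/-! ### A priori bound for the Riccati equation -/

open ContinuousLinearMap in
/-- A priori bound for solutions of the Riccati equation. -/
theorem IsRiccatiSolution.norm_le {A B C P₀ : L2I →L[ℝ] L2I} {T : ℝ} {P : ℝ → L2I →L[ℝ] L2I}
    (h : IsRiccatiSolution A B C P₀ T P) {a γ p : ℝ} (hA : ‖A‖ ≤ a) (hC : ‖C‖ ≤ γ)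
    (hP₀ : ‖P₀‖ ≤ p) {t : ℝ} (ht : t ∈ Icc 0 T) :
    ‖P t‖ ≤ (p + γ ^ 2) * Real.exp ((4 * a + 1) * t) := by
  have ha : 0 ≤ a := (norm_nonneg _).trans hA
  have hp : 0 ≤ p := (norm_nonneg _).trans hP₀
  -- A finite bound, depending on the solution, that only starts the iteration.
  obtain ⟨c, hc⟩ : ∃ c, ∀ s : Icc 0 T, ‖P s‖ ≤ c := by
    refine banach_steinhaus fun v => ?_
    obtain ⟨c, hc⟩ := isCompact_Icc.exists_bound_of_continuousOn (h.mem.continuousOn v)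
    exact ⟨c, fun s => hc s s.2⟩
  have hc0 : 0 ≤ c := (norm_nonneg _).trans (hc ⟨t, ht⟩)
  set d := p + γ ^ 2 with hd
  have hd0 : 0 ≤ d := by positivity
  have step : ∀ k : ℕ, ∀ s ∈ Icc 0 T, ‖P s‖ ≤ (c / 2 ^ k + d) * Real.exp ((4 * a + 1) * s) := by
    intro k
    induction k with
    | zero =>
      intro s hs
      have h1 : 1 ≤ Real.exp ((4 * a + 1) * s) := Real.one_le_exp (by have := hs.1; positivity)
      have h2 : c ≤ c + d := by linarith
      rw [pow_zero, div_one]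
      exact ((hc ⟨s, hs⟩).trans h2).trans (le_mul_of_one_le_right (by positivity) h1)
    | succ k ih =>
      intro s hs
      set q := c / 2 ^ k with hq
      have hq0 : 0 ≤ q := by positivity
      have e : c / 2 ^ (k + 1) = q / 2 := by rw [hq, pow_succ, div_div]
      rw [e]
      refine norm_le_of_inner_self_le (h.mem.selfAdjoint s hs) (by positivity) (h.nonneg s hs)
        fun v => ?_
      have hB : ∀ x, HasDerivAt (fun r => (q / 2 + d) * Real.exp ((4 * a + 1) * r) * ‖v‖ ^ 2)
          ((q / 2 + d) * (Real.exp ((4 * a + 1) * x) * (4 * a + 1)) * ‖v‖ ^ 2) x := by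
        intro x
        have e1 : HasDerivAt (fun r : ℝ => (4 * a + 1) * r) (4 * a + 1) x := by
          simpa using (hasDerivAt_id x).const_mul (4 * a + 1)
        exact (e1.exp.const_mul _).mul_const _
      have hd1 : ∀ r ∈ Icc 0 T, HasDerivWithinAt (fun r => inner ℝ (P r v) v) (inner ℝ
          ((adjoint A ∘L P r + P r ∘L A - P r ∘L B ∘L adjoint B ∘L P r + adjoint C ∘L C) v) v)
          (Icc 0 T) r := fun r hr => by
        simpa using (h.hasDeriv v r hr).inner ℝ (hasDerivWithinAt_const r (Icc 0 T) v)
      refine image_le_of_deriv_right_le_deriv_boundary (a := 0) (b := T)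
        (fun r hr => (hd1 r hr).continuousWithinAt)
        (fun r hr => (hd1 r (Ico_subset_Icc_self hr)).Ici_of_Icc hr) ?_
        (fun r _ => (hB r).continuousAt.continuousWithinAt)
        (fun r _ => (hB r).hasDerivWithinAt) ?_ hs
      · rw [h.initial, mul_zero, Real.exp_zero, mul_one]
        calc inner ℝ (P₀ v) v ≤ ‖P₀ v‖ * ‖v‖ := real_inner_le_norm _ _
          _ ≤ p * ‖v‖ * ‖v‖ := by gcongr; exact P₀.le_of_opNorm_le hP₀ v
          _ = p * ‖v‖ ^ 2 := by ring
          _ ≤ _ := by gcongr; have := sq_nonneg γ; linarith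
      -- In the rate `4 a + 1`, the part `4 a` halves the contribution `2 a q` of the state
      -- operator, and `1` absorbs `γ ^ 2 ≤ d`. The term in `B` has a favourable sign, so the bound
      -- does not involve `B`.
      · intro r hr'
        have hr := Ico_subset_Icc_self hr'
        have hsym : ∀ x y, inner ℝ (P r x) y = inner ℝ x (P r y) :=
          (h.mem.selfAdjoint r hr).isSymmetric
        have hexp : inner ℝ ((adjoint A ∘L P r + P r ∘L A - P r ∘L B ∘L adjoint B ∘L P r
            + adjoint C ∘L C) v) v =
            2 * inner ℝ (P r v) (A v) - ‖adjoint B (P r v)‖ ^ 2 + ‖C v‖ ^ 2 := by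
          simp only [add_apply, sub_apply, comp_apply, inner_add_left, inner_sub_left,
            adjoint_inner_left]
          have e1 : inner ℝ (B (adjoint B (P r v))) (P r v) = ‖adjoint B (P r v)‖ ^ 2 := by
            rw [← adjoint_inner_right, real_inner_self_eq_norm_sq]
          rw [hsym (A v), hsym (B _), e1, real_inner_self_eq_norm_sq, real_inner_comm (P r v) (A v)]
          ring
        rw [hexp]
        have b1 : inner ℝ (P r v) (A v) ≤
            (q + d) * Real.exp ((4 * a + 1) * r) * ‖v‖ * (a * ‖v‖) :=
          (real_inner_le_norm _ _).trans (mul_le_mul ((P r).le_of_opNorm_le (ih r hr) v)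
            (A.le_of_opNorm_le hA v) (norm_nonneg _) (by positivity))
        have b2 : ‖C v‖ ^ 2 ≤ γ ^ 2 * ‖v‖ ^ 2 := by
          rw [← mul_pow]; gcongr; exact C.le_of_opNorm_le hC v
        have h1 : 1 ≤ Real.exp ((4 * a + 1) * r) :=
          Real.one_le_exp (by have := hr.1; positivity)
        have b3 : γ ^ 2 ≤ d * Real.exp ((4 * a + 1) * r) :=
          (by rw [hd]; linarith : γ ^ 2 ≤ d).trans (le_mul_of_one_le_right hd0 h1)
        have b4 : γ ^ 2 * ‖v‖ ^ 2 ≤ d * Real.exp ((4 * a + 1) * r) * ‖v‖ ^ 2 := by gcongr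
        have b5 : 0 ≤ (q / 2 + 2 * a * d) * Real.exp ((4 * a + 1) * r) * ‖v‖ ^ 2 := by positivity
        have := sq_nonneg ‖adjoint B (P r v)‖
        linarith
  rw [← div_le_iff₀ (Real.exp_pos _)]
  refine le_of_forall_halving (c := c) fun k => ?_
  rw [div_le_iff₀ (Real.exp_pos _)]
  exact step k t ht

/-! ### Convergence of the Riccati solutions -/

theorem GraphonSystem.ConvergesTo.tendsto_opA {S : ℕ+ → GraphonSystem} {S' : GraphonSystem}
    (h : ConvergesTo S S') : Tendsto (fun N => (S N).opA) atTop (𝓝 S'.opA) := by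
  have h1 : Tendsto (fun N => (S N).A.toOp) atTop (𝓝 S'.A.toOp) := by
    rw [tendsto_iff_norm_sub_tendsto_zero]
    exact h.A.congr fun N => norm_sub_rev _ _
  exact (h.α.smul_const _).add h1

theorem GraphonSystem.ConvergesTo.tendsto_opB {S : ℕ+ → GraphonSystem} {S' : GraphonSystem}
    (h : ConvergesTo S S') : Tendsto (fun N => (S N).opB) atTop (𝓝 S'.opB) := by
  have h1 : Tendsto (fun N => (S N).B.toOp) atTop (𝓝 S'.B.toOp) := by
    rw [tendsto_iff_norm_sub_tendsto_zero]
    exact h.B.congr fun N => norm_sub_rev _ _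
  exact (h.β.smul_const _).add h1

open ContinuousLinearMap in
/-- Solutions of the Riccati equation depend continuously on the data: uniformly in the state and
input operators, strongly in the weighting operators. -/
theorem tendstoCs_of_isRiccatiSolution {A B C P₀ : L2I →L[ℝ] L2I}
    {AN BN CN PN₀ : ℕ+ → L2I →L[ℝ] L2I} {T : ℝ} (hT : 0 < T)
    {P : ℝ → L2I →L[ℝ] L2I} {PN : ℕ+ → ℝ → L2I →L[ℝ] L2I}
    (hA : Tendsto AN atTop (𝓝 A)) (hB : Tendsto BN atTop (𝓝 B))
    (hC : StrongTendsto CN C) (hP₀ : StrongTendsto PN₀ P₀)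
    (hC_sa : IsSelfAdjoint C) (hCN_sa : ∀ N, IsSelfAdjoint (CN N))
    (hP : IsRiccatiSolution A B C P₀ T P)
    (hPN : ∀ N, IsRiccatiSolution (AN N) (BN N) (CN N) (PN₀ N) T (PN N)) :
    TendstoCs T PN P := by
  obtain ⟨a, ha0, ha, haN⟩ := exists_norm_le_of_tendsto fun v =>
    ((continuous_eval_const v).tendsto A).comp hA
  obtain ⟨b, hb0, hb, hbN⟩ := exists_norm_le_of_tendsto fun v =>
    ((continuous_eval_const v).tendsto B).comp hB
  obtain ⟨γ, hγ0, hγ, hγN⟩ := exists_norm_le_of_tendsto hC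
  obtain ⟨p₀, hp₀0, hp₀, hp₀N⟩ := exists_norm_le_of_tendsto hP₀
  set p := (p₀ + γ ^ 2) * Real.exp ((4 * a + 1) * T) with hp
  have hp0 : 0 ≤ p := by positivity
  have hexp : ∀ t ∈ Icc 0 T, (p₀ + γ ^ 2) * Real.exp ((4 * a + 1) * t) ≤ p := fun t ht => by
    rw [hp]; gcongr; exact ht.2
  have hPb : ∀ t ∈ Icc 0 T, ‖P t‖ ≤ p := fun t ht =>
    (hP.norm_le ha hγ hp₀ ht).trans (hexp t ht)
  have hPNb : ∀ N, ∀ t ∈ Icc 0 T, ‖PN N t‖ ≤ p := fun N t ht =>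
    ((hPN N).norm_le (haN N) (hγN N) (hp₀N N) ht).trans (hexp t ht)
  have hadj : ∀ {X : L2I →L[ℝ] L2I} {x : ℝ}, ‖X‖ ≤ x → ‖adjoint X‖ ≤ x := fun h => by
    rwa [LinearIsometryEquiv.norm_map]
  have hBB : Tendsto (fun N => BN N ∘L adjoint (BN N)) atTop (𝓝 (B ∘L adjoint B)) :=
    hB.mul ((adjoint.continuous.tendsto B).comp hB)
  have hA' : Tendsto (fun N => adjoint (AN N)) atTop (𝓝 (adjoint A)) :=
    (adjoint.continuous.tendsto A).comp hA
  -- Strong convergence does not pass to adjoints in general; self-adjointness reduces `C_Nᵀ C_N` to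
  -- a square, whose strong limit needs only the uniform bound `γ`.
  have hCC : ∀ v, Tendsto (fun N => CN N (CN N v)) atTop (𝓝 (C (C v))) := by
    intro v
    have h1 : Tendsto (fun N => CN N (CN N v - C v)) atTop (𝓝 0) := by
      refine squeeze_zero_norm (fun N => (CN N).le_of_opNorm_le (hγN N) _) ?_
      simpa using (tendsto_iff_norm_sub_tendsto_zero.1 (hC v)).const_mul γ
    simpa using h1.add (hC (C v))
  have hKb : ‖B ∘L adjoint B‖ ≤ b * b :=
    (opNorm_comp_le _ _).trans (mul_le_mul hb (hadj hb) (norm_nonneg _) hb0)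
  have hKNb : ∀ N, ‖BN N ∘L adjoint (BN N)‖ ≤ b * b := fun N =>
    (opNorm_comp_le _ _).trans (mul_le_mul (hbN N) (hadj (hbN N)) (norm_nonneg _) hb0)
  refine ⟨fun N => (hPN N).mem, hP.mem, fun v => ?_⟩
  rw [Metric.tendstoUniformlyOn_iff]
  intro ε hε
  have key := eventually_norm_le_of_hasDerivWithinAt (l := atTop) hT
    (D := fun N t => PN N t - P t)
    (G := fun N t => adjoint (AN N) - PN N t ∘L (BN N ∘L adjoint (BN N)))
    (R := fun N t => (adjoint (AN N) - adjoint A) ∘L P t + PN N t ∘L (AN N - A)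
      - PN N t ∘L (BN N ∘L adjoint (BN N) - B ∘L adjoint B) ∘L P t + (CN N ∘L CN N - C ∘L C))
    (F := fun t => A - (B ∘L adjoint B) ∘L P t)
    (c := p + p) (m := a + p * (b * b))
    (fun N t ht => norm_sub_le_of_le (hPNb N t ht) (hPb t ht))
    (fun N t ht => norm_sub_le_of_le (hadj (haN N)) ((opNorm_comp_le _ _).trans
      (mul_le_mul (hPNb N t ht) (hKNb N) (norm_nonneg _) hp0)))
    (by positivity) (by positivity)
    (fun t ht => norm_sub_le_of_le ha (((opNorm_comp_le _ _).trans
      (mul_le_mul hKb (hPb t ht) (norm_nonneg _) (by positivity))).trans_eq (mul_comm _ _)))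
    (fun v => continuousOn_const.sub
      ((B ∘L adjoint B).continuous.comp_continuousOn (hP.mem.continuousOn v)))
    ?_ ?_ ?_ v (half_pos hε)
  · filter_upwards [key] with N hN t ht
    rw [dist_comm, dist_eq_norm]
    exact (hN t ht).trans_lt (half_lt_self hε)
  · intro N v t ht
    refine (((hPN N).hasDeriv v t ht).sub (hP.hasDeriv v t ht)).congr_deriv ?_
    rw [(hCN_sa N).adjoint_eq, hC_sa.adjoint_eq]
    simp only [add_apply, sub_apply, comp_apply, map_sub]
    abel
  · intro v ε hε
    have h1 := (tendsto_iff_norm_sub_tendsto_zero.1 (hP₀ v)).eventually_le_const hε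
    filter_upwards [h1] with N hN
    rwa [(hPN N).initial, hP.initial, sub_apply]
  -- Norm convergence of the state and input operators makes the errors acting on `P t v` uniform in
  -- `t`.
  · intro v ε hε
    have h1 := tendsto_iff_norm_sub_tendsto_zero.1 hA'
    have h2 := tendsto_iff_norm_sub_tendsto_zero.1 hA
    have h3 := tendsto_iff_norm_sub_tendsto_zero.1 hBB
    have h4 := tendsto_iff_norm_sub_tendsto_zero.1 (hCC v)
    have h5 := (((h1.mul_const (p * ‖v‖)).add ((h2.mul_const ‖v‖).const_mul p)).add
      ((h3.mul_const (p * ‖v‖)).const_mul p)).add h4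
    simp only [zero_mul, mul_zero, add_zero] at h5
    filter_upwards [h5.eventually_le_const hε] with N hN t ht
    refine le_trans ?_ hN
    have c1 := (P t).le_of_opNorm_le (hPb t ht) v
    simp only [add_apply, sub_apply (f := _ + _), comp_apply]
    refine norm_add_le_of_le (norm_sub_le_of_le (norm_add_le_of_le ?_ ?_) ?_) le_rfl
    · exact (le_opNorm _ _).trans (by gcongr)
    · exact ((PN N t).le_of_opNorm_le (hPNb N t ht) _).trans (by gcongr; exact le_opNorm _ _)
    · refine ((PN N t).le_of_opNorm_le (hPNb N t ht) _).trans ?_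
      gcongr
      exact (le_opNorm _ _).trans (by gcongr)

theorem mainTheorem3
    (n : ℕ+) (S : ∀ N : ℕ+, NetworkSystem n N) (S' : GraphonSystem)
    (C : L2I →L[ℝ] L2I) (CN : ℕ+ → L2I →L[ℝ] L2I)
    (P₀ : L2I →L[ℝ] L2I) (PN₀ : ℕ+ → L2I →L[ℝ] L2I)
    (hPN₀ : ∀ N, IsSelfAdjoint (PN₀ N) ∧ ∀ v : L2I, 0 ≤ inner ℝ (PN₀ N v) v)
    (hS : GraphonSystem.ConvergesTo (fun N => (S N).toGraphonSystem) S')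
    (hC : StrongTendsto CN C) (hP₀ : StrongTendsto PN₀ P₀)
    (hC_sa : IsSelfAdjoint C) (hCN_sa : ∀ N, IsSelfAdjoint (CN N))
    (T : ℝ) (hT : 0 < T)
    (P : ℝ → L2I →L[ℝ] L2I) (PN : ℕ+ → ℝ → L2I →L[ℝ] L2I)
    (hP : IsRiccatiSolution S'.opA S'.opB C P₀ T P)
    (hPN : ∀ N, IsRiccatiSolution (S N).toGraphonSystem.opA (S N).toGraphonSystem.opB
      (CN N) (PN₀ N) T (PN N)) :
    TendstoCs T PN P := by
  exact tendstoCs_of_isRiccatiSolution hT hS.tendsto_opA hS.tendsto_opB hC hP₀ hC_sa hCN_sa hP hPN
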